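/- Let $k\ge 1$. A nondeterministic two-way $k$-head finite automaton ($2\mathrm{NFA}(k)$) consists of a finite set $S$ of states, a finite input alphabet $A$, two endmarkers $\vartriangleright,\vartriangleleft\notin A$, an initial state $s_0\in S$, a set $F\subseteq S$ of accepting states, and a partial transition function $\delta$ from $S\times(A\cup\{\vartriangleright,\vartriangleleft\})^k$ to the subsets of $S\times\{-1,0,1\}^k$, such that no head moves left on $\vartriangleright$ or right on $\vartriangleleft$. The tape for an input $w\in A^*$ has squares $0,\dots,|w|+1$ carrying $\vartriangleright w\vartriangleleft$; the computation starts in state $s_0$ with all heads on square $1$. In state $s$ with scanned symbols $a_1,\dots,a_k$, a step chooses some $(s',(d_1,\dots,d_k))\in\delta(s,(a_1,\dots,a_k))$, changes the state to $s'$ and moves head $i$ by $d_i$; the automaton halts when $\delta$ is undefined at the current state and scanned symbols. The accepted language is the set of all $w\in A^*$ on which some computation halts in a state of $F$. The automaton is deterministic if every defined value of $\delta$ is a singleton, and one-way if no transition moves a head to the left. Write $2\mathrm{DFA}(k)$, $1\mathrm{NFA}(k)$ and $1\mathrm{DFA}(k)$ for the deterministic two-way, the nondeterministic one-way, and the deterministic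 one-way $k$-head finite automata. Theorem. Let $k\ge 2$ and let $X$ be any one of the four types $1\mathrm{DFA}(k)$, $1\mathrm{NFA}(k)$, $2\mathrm{DFA}(k)$, $2\mathrm{NFA}(k)$. Then there is no algorithm (partial recursive function on finite descriptions of automata) that, given a description of any automaton $M$ of type $X$ (with any input alphabet), halts and outputs a description of an automaton of type $X$ over the same input alphabet that accepts the same language as $M$ and has the minimal number of states among all automata of type $X$ over that alphabet accepting that language. -/

import Mathlib

/-- The symbols a head can scan: the letters of the input alphabet `A` and two endmarkers,
which are not letters. -/
inductive TapeSymbol (A : Type*) where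
  | leftEnd : TapeSymbol A
  | letter : A → TapeSymbol A
  | rightEnd : TapeSymbol A

/-- A nondeterministic two-way `k`-head finite automaton with input alphabet `A` and state set `S`.
The transition function is partial (`none` is "undefined") with sets of pairs
(new state, head moves) as values. A move `1` goes one square to the right, `-1` one square to the
left, and `0` stays. Heads cannot move beyond the endmarkers. -/
structure MultiHeadFA (k : ℕ) (A S : Type*) where
  δ : S → (Fin k → TapeSymbol A) → Option (Set (S × (Fin k → SignType)))
  start : S
  accept : Set S
  leftEnd_bound : ∀ s a T t, δ s a = some T → t ∈ T →
    ∀ i, a i = TapeSymbol.leftEnd → t.2 i ≠ -1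
  rightEnd_bound : ∀ s a T t, δ s a = some T → t ∈ T →
    ∀ i, a i = TapeSymbol.rightEnd → t.2 i ≠ 1

namespace MultiHeadFA

/-- The inscription of square `p ∈ {0, …, |w| + 1}` of the tape with input `w`: square `0` carries
the left endmarker, squares `1, …, |w|` the letters of `w`, and square `|w| + 1` the right
endmarker. -/
def scan {A : Type*} (w : List A) (p : Fin (w.length + 2)) : TapeSymbol A :=
  if p.val = 0 then TapeSymbol.leftEnd
  else match w[p.val - 1]? with
    | some a => TapeSymbol.letter a
    | none => TapeSymbol.rightEnd

/-- A configuration on input `w`: the current state and the current head positions. -/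
structure Config (k : ℕ) {A : Type*} (S : Type*) (w : List A) where
  state : S
  pos : Fin k → Fin (w.length + 2)

variable {k : ℕ} {A S : Type*}

/-- The initial configuration: every head is on square `1`. -/
def init (M : MultiHeadFA k A S) (w : List A) : Config k S w where
  state := M.start
  pos := fun _ => ⟨1, by omega⟩

/-- The value (or undefinedness) of the transition function in a configuration. -/
def situation (M : MultiHeadFA k A S) {w : List A} (c : Config k S w) :
    Option (Set (S × (Fin k → SignType))) :=
  M.δ c.state (fun i => scan w (c.pos i))

/-- The successor relation on configurations. -/
def Step (M : MultiHeadFA k A S) (w : List A) (c c' : Config k S w) : Prop :=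
  ∃ T, M.situation c = some T ∧ ∃ d : Fin k → SignType, (c'.state, d) ∈ T ∧
    ∀ i, ((c'.pos i : ℕ) : ℤ) = ((c.pos i : ℕ) : ℤ) + ((d i : SignType) : ℤ)

/-- The automaton halts in `c` when the transition function is undefined there. -/
def Halts (M : MultiHeadFA k A S) {w : List A} (c : Config k S w) : Prop :=
  M.situation c = none

/-- The accepted language: the words on which some computation from the initial configuration
halts in an accepting state. -/
def language (M : MultiHeadFA k A S) : Language A :=
  {w | ∃ c : Config k S w, Relation.ReflTransGen (M.Step w) (M.init w) c ∧
    c.state ∈ M.accept ∧ M.Halts c}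

/-- Everywhere the transition function is undefined or a singleton. -/
def IsDeterministic (M : MultiHeadFA k A S) : Prop :=
  ∀ s a T, M.δ s a = some T → ∃ t, T = {t}

/-- No head ever moves to the left. -/
def IsOneWay (M : MultiHeadFA k A S) : Prop :=
  ∀ s a T t, M.δ s a = some T → t ∈ T → ∀ i, t.2 i ≠ -1

/-- The four types of `k`-head finite automata. -/
inductive Kind where
  | oneWayDet | oneWayNondet | twoWayDet | twoWayNondet

/-- `M` is an automaton of the given type. -/
def HasKind (M : MultiHeadFA k A S) : Kind → Prop
  | Kind.oneWayDet => M.IsOneWay ∧ M.IsDeterministic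
  | Kind.oneWayNondet => M.IsOneWay
  | Kind.twoWayDet => M.IsDeterministic
  | Kind.twoWayNondet => True

/-- `N`, with finite state set, has the least number of states among all automata of type `t`
that accept the same language as `N`. -/
def IsStateMinimal {A S : Type} [Fintype S] (N : MultiHeadFA k A S) (t : Kind) : Prop :=
  ∀ (S' : Type) [Fintype S'] (N' : MultiHeadFA k A S'), N'.HasKind t →
    N'.language = N.language → Fintype.card S ≤ Fintype.card S'

end MultiHeadFA

/-- The finite data by which a `k`-head automaton with states `0, …, numStates - 1` and input
letters `0, …, numLetters - 1` is written down: its initial state, a list of its accepting states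
and the table of its transition function, whose entries consist of an argument
(state, scanned symbols) and a list of the elements (new state, moves) of the value there. -/
structure MultiHeadCode (k : ℕ) where
  numStates : ℕ
  numLetters : ℕ
  start : ℕ
  accept : List ℕ
  table : List ((ℕ × (Fin k → ℕ)) × List (ℕ × (Fin k → ℕ)))

namespace MultiHeadCode

/-- Codes as tuples. -/
def equivTuple (k : ℕ) : MultiHeadCode k ≃
    ℕ × ℕ × ℕ × List ℕ × List ((ℕ × (Fin k → ℕ)) × List (ℕ × (Fin k → ℕ))) where
  toFun c := (c.numStates, c.numLetters, c.start, c.accept, c.table)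
  invFun x := ⟨x.1, x.2.1, x.2.2.1, x.2.2.2.1, x.2.2.2.2⟩
  left_inv _ := rfl
  right_inv _ := rfl

instance instPrimcodable (k : ℕ) : Primcodable (MultiHeadCode k) :=
  Primcodable.ofEquiv _ (equivTuple k)

/-- The number that stands for a tape symbol. -/
def symbolCode {m : ℕ} : TapeSymbol (Fin m) → ℕ
  | TapeSymbol.leftEnd => 0
  | TapeSymbol.rightEnd => 1
  | TapeSymbol.letter a => a.val + 2

/-- The number that stands for a head move. -/
def moveCode : SignType → ℕ
  | SignType.zero => 0
  | SignType.pos => 1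
  | SignType.neg => 2

/-- The code of an argument of the transition function. -/
def argCode {k m n : ℕ} (q : Fin n) (a : Fin k → TapeSymbol (Fin m)) : ℕ × (Fin k → ℕ) :=
  (q.val, fun i => symbolCode (a i))

/-- The code of an element of a value of the transition function. -/
def targetCode {k n : ℕ} (t : Fin n × (Fin k → SignType)) : ℕ × (Fin k → ℕ) :=
  (t.1.val, fun i => moveCode (t.2 i))

/-- `c` is a description of the automaton `M`. The order and repetitions in the lists of `c` are
immaterial. -/
structure Describes {k m n : ℕ} (c : MultiHeadCode k) (M : MultiHeadFA k (Fin m) (Fin n)) :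
    Prop where
  numStates_eq : c.numStates = n
  numLetters_eq : c.numLetters = m
  start_eq : c.start = M.start.val
  mem_accept : ∀ x, x ∈ c.accept ↔ ∃ q ∈ M.accept, x = q.val
  table_sound : ∀ e ∈ c.table, ∃ q a T, e.1 = argCode q a ∧ M.δ q a = some T ∧
    ∀ x, x ∈ e.2 ↔ ∃ t ∈ T, x = targetCode t
  table_complete : ∀ q a T, M.δ q a = some T → ∃ e ∈ c.table, e.1 = argCode q a

end MultiHeadCode

/-- The partial function `f` on codes performs state minimization for the `k`-head automata of
type `t`: on every description of an automaton `M` of type `t` it is defined, and its value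
describes an automaton of type `t` with the same input alphabet that accepts the same language
and has the least possible number of states. -/
def IsStateMinimization (k : ℕ) (t : MultiHeadFA.Kind)
    (f : MultiHeadCode k →. MultiHeadCode k) : Prop :=
  ∀ (m n : ℕ) (M : MultiHeadFA k (Fin m) (Fin n)), M.HasKind t →
    ∀ c : MultiHeadCode k, c.Describes M →
      ∃ c' ∈ f c, ∃ (n' : ℕ) (N : MultiHeadFA k (Fin m) (Fin n')),
        c'.Describes N ∧ N.HasKind t ∧ N.language = M.language ∧ N.IsStateMinimal t

/-! The halting problem reduces to minimization. From a search problem "is there `y` with `g n y =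
0`" that is primitive recursive in `n`, `y` and undecidable in `n`
(`exists_primrec_not_computablePred`), `QueueInstr.exists_automata` computes automata `M n` of all
four types at once whose languages are pairwise disjoint and are nonempty exactly for the solvable
instances.

Suppose minimization is computable, and let `h n` be the number of states of the minimized `M n`. If
instance `n` is unsolvable, the language is empty and `h n = 1`
(`MultiHeadFA.card_eq_one_of_isStateMinimal`). Conversely, one-state automata over two letters
accept only finitely many languages (`MultiHeadFA.finite_range_language`), and disjoint nonempty
languages are distinct, so `h n = 1` for only finitely many solvable `n`. Hence `h` decides
solvability up to finitely many errors, and so solvability is decidable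
(`ComputablePred.of_finite_diff`), a contradiction.

For `M n`, two one-way heads verify the run of a queue machine: the input must begin with the word
of all letters ever pushed. One head checks each new letter, the other follows at the front of the
queue; `Represents.transition_eq` is the one-step correspondence. Queue machines are universal: a
queue of unary blocks, cyclically rotated, holds registers, and loops over registers give all
primitive recursive functions (`QueueProg.addsValue_of_primrec'`) and then unbounded search
(`QueueProg.exists_search_program`). The machine for `n` first pushes `0 … 0 1` with `n` zeros,
which both supplies its argument and makes the languages disjoint. -/

/-! ### Queue machines. -/

/-- The instructions of a machine whose memory is a queue of letters from `Fin 2`. -/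
inductive QueueInstr (S : Type) where
  | halt : QueueInstr S
  | jump : S → QueueInstr S
  | push : Fin 2 → S → QueueInstr S
  | pop : S → QueueInstr S
  | test : S → S → QueueInstr S

namespace QueueInstr

def map {S S' : Type} (φ : S → S') : QueueInstr S → QueueInstr S'
  | halt => halt
  | jump s => jump (φ s)
  | push x s => push x (φ s)
  | pop s => pop (φ s)
  | test s s' => test (φ s) (φ s')

end QueueInstr

/-- A configuration of a queue machine: the control state, the letters removed from the queue so
far, and the queue. -/
structure QueueConfig (S : Type) where
  state : S
  past : List (Fin 2)
  queue : List (Fin 2)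

namespace QueueConfig

def map {S S' : Type} (φ : S → S') (c : QueueConfig S) : QueueConfig S' :=
  ⟨φ c.state, c.past, c.queue⟩

end QueueConfig

namespace QueueInstr

/-- One step of the queue machine with program `prog`. -/
def next {S : Type} (prog : S → QueueInstr S) (c : QueueConfig S) : Option (QueueConfig S) :=
  match prog c.state, c.queue with
  | halt, _ => none
  | jump s, u => some ⟨s, c.past, u⟩
  | push x s, u => some ⟨s, c.past, u ++ [x]⟩
  | pop _, [] => none
  | pop s, x :: u => some ⟨s, c.past ++ [x], u⟩
  | test _ _, [] => none
  | test s s', x :: u => some ⟨if x = 0 then s else s', c.past, x :: u⟩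

variable {S S' : Type}

/-- Control states enter a step only through their instructions, so renaming them, even
non-injectively, commutes with stepping. This lets a finite machine be analysed through the infinite
one whose states are lists of programs. -/
theorem next_map {prog : S → QueueInstr S} {prog' : S' → QueueInstr S'} {φ : S → S'}
    (h : ∀ s, (prog s).map φ = prog' (φ s)) (c : QueueConfig S) :
    next prog' (c.map φ) = (next prog c).map (QueueConfig.map φ) := by
  obtain ⟨s, d, u⟩ := c
  have hs := h s
  unfold next
  simp only [QueueConfig.map, ← hs]
  cases prog s <;> cases u <;> simp [map, QueueConfig.map, apply_ite]

/-- Reachability of configurations. -/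
def Reaches (prog : S → QueueInstr S) : QueueConfig S → QueueConfig S → Prop :=
  Relation.ReflTransGen fun c c' => next prog c = some c'

theorem reaches_map_of_reaches {prog : S → QueueInstr S} {prog' : S' → QueueInstr S'} {φ : S → S'}
    (h : ∀ s, (prog s).map φ = prog' (φ s)) {c c' : QueueConfig S} (hc : Reaches prog c c') :
    Reaches prog' (c.map φ) (c'.map φ) := by
  induction hc with
  | refl => exact .refl
  | tail _ h₂ ih =>
    refine ih.tail ?_
    rw [next_map h, h₂]
    rfl

theorem exists_reaches_of_reaches_map {prog : S → QueueInstr S} {prog' : S' → QueueInstr S'}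
    {φ : S → S'} (h : ∀ s, (prog s).map φ = prog' (φ s)) {c : QueueConfig S} {e : QueueConfig S'}
    (hc : Reaches prog' (c.map φ) e) : ∃ c', e = c'.map φ ∧ Reaches prog c c' := by
  induction hc with
  | refl => exact ⟨c, rfl, .refl⟩
  | tail _ h₂ ih =>
    obtain ⟨c', rfl, hc'⟩ := ih
    rw [next_map h, Option.map_eq_some_iff] at h₂
    obtain ⟨c'', h₃, rfl⟩ := h₂
    exact ⟨c'', rfl, hc'.tail h₃⟩

/-- Determinism: all configurations reachable from `c` lie on one path, and a halted one is its end.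
-/
theorem Reaches.of_halted {prog : S → QueueInstr S} {c c₁ c₂ : QueueConfig S}
    (h₁ : Reaches prog c c₁) (h₂ : Reaches prog c c₂) (hh : next prog c₂ = none) :
    Reaches prog c₁ c₂ := by
  induction h₁ using Relation.ReflTransGen.head_induction_on with
  | refl => exact h₂
  | head hs _ ih =>
    rcases Relation.ReflTransGen.cases_head h₂ with rfl | ⟨c', hs', hr⟩
    · rw [hh] at hs; cases hs
    · rw [hs] at hs'
      cases hs'
      exact ih hr

/-- If every configuration in `C` leads to another one in `C` in at least one step, then the machine
started in `C` never halts. -/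
theorem next_ne_none_of_reaches {prog : S → QueueInstr S} {C : Set (QueueConfig S)}
    (hC : ∀ c ∈ C, ∃ c₁, next prog c = some c₁ ∧ ∃ c' ∈ C, Reaches prog c₁ c')
    {c c' : QueueConfig S} (hc : c ∈ C) (h : Reaches prog c c') : next prog c' ≠ none := by
  -- By determinism the run always lies on a segment leading to a point of `C`; on arrival, the
  -- hypothesis supplies the next segment.
  have key : ∃ e ∈ C, Reaches prog c' e := by
    induction h with
    | refl => exact ⟨c, hc, .refl⟩
    | tail _ hs ih =>
      obtain ⟨e, he, hr⟩ := ih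
      rcases Relation.ReflTransGen.cases_head hr with rfl | ⟨c', hs', hr⟩
      · obtain ⟨c₁, h₁, e', he', hr'⟩ := hC _ he
        rw [hs] at h₁
        cases h₁
        exact ⟨e', he', hr'⟩
      · rw [hs] at hs'
        cases hs'
        exact ⟨e, he, hr⟩
  obtain ⟨e, he, hr⟩ := key
  rcases Relation.ReflTransGen.cases_head hr with rfl | ⟨c₁, hs, _⟩
  · obtain ⟨c₁, h₁, _⟩ := hC _ he
    simp [h₁]
  · simp [hs]

/-- The word `past ++ queue` lists everything ever pushed: a pop only shifts the boundary, and a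
push appends. -/
theorem past_append_queue_prefix_of_next {prog : S → QueueInstr S} {c c' : QueueConfig S}
    (h : next prog c = some c') : c.past ++ c.queue <+: c'.past ++ c'.queue := by
  obtain ⟨s, d, u⟩ := c
  unfold next at h
  cases hi : prog s <;> cases u <;> simp [hi] at h <;> subst h <;> simp

theorem past_append_queue_prefix {prog : S → QueueInstr S} {c c' : QueueConfig S}
    (h : Reaches prog c c') : c.past ++ c.queue <+: c'.past ++ c'.queue := by
  induction h with
  | refl => exact List.prefix_refl _
  | tail _ h₂ ih => exact ih.trans (past_append_queue_prefix_of_next h₂)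

/-! ### The automaton of a queue machine -/

/-- The head that reads what is added to the queue. -/
def writer {k : ℕ} (hk : 2 ≤ k) : Fin k := ⟨0, by omega⟩

/-- The head on the first letter of the queue. -/
def reader {k : ℕ} (hk : 2 ≤ k) : Fin k := ⟨1, by omega⟩

theorem reader_ne_writer {k : ℕ} (hk : 2 ≤ k) : reader hk ≠ writer hk := by
  simp [reader, writer]

theorem writer_ne_reader {k : ℕ} (hk : 2 ≤ k) : writer hk ≠ reader hk := by
  simp [reader, writer]

/-- The moves in which only head `i` advances. -/
def advance {k : ℕ} (i : Fin k) : Fin k → SignType := fun j => if j = i then 1 else 0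

open TapeSymbol in
/-- The transition of the automaton that belongs to an instruction. -/
def transition {k : ℕ} (hk : 2 ≤ k) (a : Fin k → TapeSymbol (Fin 2)) :
    QueueInstr S → Option (S × (Fin k → SignType))
  | halt => none
  | jump s => some (s, fun _ => 0)
  | push x s =>
    match a (writer hk) with
    | letter y => if y = x then some (s, advance (writer hk)) else none
    | _ => none
  | pop s =>
    match a (reader hk) with
    | letter _ => some (s, advance (reader hk))
    | _ => none
  | test s s' =>
    match a (reader hk) with
    | letter y => some (if y = 0 then s else s', fun _ => 0)
    | _ => none

theorem transition_ne_neg_one {k : ℕ} (hk : 2 ≤ k) {a : Fin k → TapeSymbol (Fin 2)}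
    {i : QueueInstr S} {t : S × (Fin k → SignType)} (h : i.transition hk a = some t) (j : Fin k) :
    t.2 j ≠ -1 := by
  cases i <;> simp only [transition] at h <;> (try split at h) <;> (try split at h) <;>
    simp at h <;> subst h <;> simp [advance] <;> split <;> decide

/-- A head advances only after it has been seen to scan a letter. -/
theorem transition_ne_one {k : ℕ} (hk : 2 ≤ k) {a : Fin k → TapeSymbol (Fin 2)}
    {i : QueueInstr S} {t : S × (Fin k → SignType)} (h : i.transition hk a = some t) (j : Fin k)
    (ha : a j = TapeSymbol.rightEnd) : t.2 j ≠ 1 := by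
  cases i <;> simp only [transition] at h <;> (try split at h) <;> (try split at h) <;>
    simp at h <;> subst h <;> simp [advance] <;> rintro rfl <;> simp_all

/-- The one-way deterministic automaton that checks that its input is the sequence of letters that
the queue machine adds to its queue, up to halting. -/
def toFA {k : ℕ} (hk : 2 ≤ k) (prog : S → QueueInstr S) (start : S) :
    MultiHeadFA k (Fin 2) S where
  δ s a := ((prog s).transition hk a).map fun t => {t}
  start := start
  accept := {s | prog s = halt}
  leftEnd_bound s a T t h ht i _ := by
    rw [Option.map_eq_some_iff] at h
    obtain ⟨t', h', rfl⟩ := h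
    cases ht
    exact transition_ne_neg_one hk h' i
  rightEnd_bound s a T t h ht i ha := by
    rw [Option.map_eq_some_iff] at h
    obtain ⟨t', h', rfl⟩ := h
    cases ht
    exact transition_ne_one hk h' i ha

theorem hasKind_toFA {k : ℕ} (hk : 2 ≤ k) (prog : S → QueueInstr S) (start : S)
    (t : MultiHeadFA.Kind) : (toFA hk prog start).HasKind t := by
  have h₁ : (toFA hk prog start).IsOneWay := by
    intro s a T t h ht i
    simp only [toFA, Option.map_eq_some_iff] at h
    obtain ⟨t', h', rfl⟩ := h
    cases ht
    exact transition_ne_neg_one hk h' i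
  have h₂ : (toFA hk prog start).IsDeterministic := by
    intro s a T h
    simp only [toFA, Option.map_eq_some_iff] at h
    obtain ⟨t', h', rfl⟩ := h
    exact ⟨t', rfl⟩
  cases t
  · exact ⟨h₁, h₂⟩
  · exact h₁
  · exact h₂
  · trivial

/-- The configuration of the automaton on input `w` represents a configuration of the queue
machine. -/
structure Represents {k : ℕ} (hk : 2 ≤ k) {w : List (Fin 2)} (e : MultiHeadFA.Config k S w)
    (c : QueueConfig S) : Prop where
  state_eq : e.state = c.state
  isPrefix : c.past ++ c.queue <+: w
  reader_eq : (e.pos (reader hk)).val = c.past.length + 1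
  writer_eq : (e.pos (writer hk)).val = c.past.length + c.queue.length + 1

theorem scan_eq {w : List (Fin 2)} {p : Fin (w.length + 2)} {i : ℕ} (h : p.val = i + 1) :
    MultiHeadFA.scan w p = match w[i]? with
      | some a => TapeSymbol.letter a
      | none => TapeSymbol.rightEnd := by
  simp only [MultiHeadFA.scan, h, Nat.add_sub_cancel, Nat.add_eq_zero_iff, one_ne_zero, and_false,
    if_false]
  cases w[i]? <;> rfl

theorem Represents.scan_reader {k : ℕ} {hk : 2 ≤ k} {w : List (Fin 2)}
    {e : MultiHeadFA.Config k S w} {c : QueueConfig S} (h : Represents hk e c) {x : Fin 2}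
    {u : List (Fin 2)} (hu : c.queue = x :: u) :
    MultiHeadFA.scan w (e.pos (reader hk)) = TapeSymbol.letter x := by
  rw [scan_eq h.reader_eq]
  obtain ⟨v, rfl⟩ := h.isPrefix
  simp [hu]

/-- The writer is on the first square after the letters pushed so far, so it compares the next
pushed letter with the input. -/
theorem Represents.scan_writer {k : ℕ} {hk : 2 ≤ k} {w : List (Fin 2)}
    {e : MultiHeadFA.Config k S w} {c : QueueConfig S} (h : Represents hk e c) (x : Fin 2) :
    MultiHeadFA.scan w (e.pos (writer hk)) = TapeSymbol.letter x ↔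
      c.past ++ (c.queue ++ [x]) <+: w := by
  rw [scan_eq h.writer_eq]
  obtain ⟨v, rfl⟩ := h.isPrefix
  rw [← List.append_assoc, List.prefix_append_right_inj, List.getElem?_append_right (by simp)]
  simp only [List.length_append, Nat.sub_self]
  cases v <;> simp [eq_comm]

theorem represents_init {k : ℕ} (hk : 2 ≤ k) (prog : S → QueueInstr S) (start : S)
    (w : List (Fin 2)) : Represents hk ((toFA hk prog start).init w) ⟨start, [], []⟩ where
  state_eq := rfl
  isPrefix := by simp
  reader_eq := rfl
  writer_eq := rfl

/-- A step of the automaton in terms of the transition. -/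
theorem step_toFA_iff {k : ℕ} (hk : 2 ≤ k) (prog : S → QueueInstr S) (start : S)
    {w : List (Fin 2)} {e e' : MultiHeadFA.Config k S w} :
    (toFA hk prog start).Step w e e' ↔
      ∃ d, (prog e.state).transition hk (fun i => MultiHeadFA.scan w (e.pos i)) =
        some (e'.state, d) ∧ ∀ i, ((e'.pos i : ℕ) : ℤ) = ((e.pos i : ℕ) : ℤ) + ((d i : SignType) : ℤ) := by
  simp only [MultiHeadFA.Step, MultiHeadFA.situation, toFA, Option.map_eq_some_iff]
  constructor
  · rintro ⟨T, ⟨t, ht, rfl⟩, d, hd, h⟩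
    cases hd
    exact ⟨d, ht, h⟩
  · rintro ⟨d, hd, h⟩
    exact ⟨_, ⟨_, hd, rfl⟩, d, rfl, h⟩

/-- Only a push can fail, namely when the pushed letter disagrees with the input. The other
instructions leave `past ++ queue` unchanged, so for them the prefix condition is already known. The
vector `d` records how the two ends of the queue move. -/
theorem Represents.transition_eq {k : ℕ} {hk : 2 ≤ k} {prog : S → QueueInstr S}
    {w : List (Fin 2)} {e : MultiHeadFA.Config k S w} {c c' : QueueConfig S}
    (h : Represents hk e c) (hs : next prog c = some c') :
    ∃ d : Fin k → SignType,
      (∀ t, (prog e.state).transition hk (fun i => MultiHeadFA.scan w (e.pos i)) = some t ↔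
        c'.past ++ c'.queue <+: w ∧ t = (c'.state, d)) ∧
      (c'.past.length : ℤ) = c.past.length + (d (reader hk) : ℤ) ∧
      (c'.past.length + c'.queue.length : ℤ) =
        c.past.length + c.queue.length + (d (writer hk) : ℤ) ∧
      ∀ i, i ≠ reader hk → i ≠ writer hk → d i = 0 := by
  obtain ⟨s, d, u⟩ := c
  have hp := h.isPrefix
  have hw := h.scan_writer
  have hr := fun x v => h.scan_reader (x := x) (u := v)
  have hse := h.state_eq
  simp only at hp hw hr hse
  unfold next at hs
  rw [hse]
  cases hi : prog s with
  | halt => simp [hi] at hs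
  | jump s' =>
    simp only [hi, Option.some.injEq] at hs
    subst hs
    exact ⟨fun _ => 0, by simp [transition, hp, eq_comm], by simp⟩
  | push x s' =>
    simp only [hi, Option.some.injEq] at hs
    subst hs
    refine ⟨advance (writer hk), fun t => ?_, by simp [advance, reader_ne_writer],
      by simp [advance, add_assoc], fun i _ hi => by simp [advance, hi]⟩
    rw [← hw x]
    simp only [transition]
    cases MultiHeadFA.scan w (e.pos (writer hk)) with
    | leftEnd => simp
    | rightEnd => simp
    | letter y =>
      by_cases hy : y = x
      · simp [hy, eq_comm]
      · simp [hy]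
  | pop s' =>
    cases u with
    | nil => simp [hi] at hs
    | cons x u =>
      simp only [hi, Option.some.injEq] at hs
      subst hs
      refine ⟨advance (reader hk), fun t => ?_, by simp [advance],
        by simp [advance, writer_ne_reader]; ring, fun i hi _ => by simp [advance, hi]⟩
      simp [transition, hr x u rfl, hp, eq_comm]
  | test s' s'' =>
    cases u with
    | nil => simp [hi] at hs
    | cons x u =>
      simp only [hi, Option.some.injEq] at hs
      subst hs
      exact ⟨fun _ => 0, by simp [transition, hr x u rfl, hp, eq_comm], by simp⟩

theorem Represents.step {k : ℕ} {hk : 2 ≤ k} {prog : S → QueueInstr S} {start : S}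
    {w : List (Fin 2)} {e e' : MultiHeadFA.Config k S w} {c c' : QueueConfig S}
    (h : Represents hk e c) (hs : next prog c = some c')
    (he : (toFA hk prog start).Step w e e') : Represents hk e' c' := by
  obtain ⟨d, h₁, h₂, h₃, -⟩ := h.transition_eq hs
  obtain ⟨d', ht, hpos⟩ := (step_toFA_iff hk prog start).1 he
  obtain ⟨hp, ht⟩ := (h₁ _).1 ht
  simp only [Prod.mk.injEq] at ht
  obtain ⟨hst, rfl⟩ := ht
  have hr := hpos (reader hk)
  have hw := hpos (writer hk)
  rw [h.reader_eq] at hr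
  rw [h.writer_eq] at hw
  exact ⟨hst, hp, by push_cast at hr; omega, by push_cast at hw; omega⟩

theorem Represents.exists_step {k : ℕ} {hk : 2 ≤ k} {prog : S → QueueInstr S} {start : S}
    {w : List (Fin 2)} {e : MultiHeadFA.Config k S w} {c c' : QueueConfig S}
    (h : Represents hk e c) (hs : next prog c = some c') (hp : c'.past ++ c'.queue <+: w) :
    ∃ e', (toFA hk prog start).Step w e e' ∧ Represents hk e' c' := by
  obtain ⟨d, h₁, h₂, h₃, h₄⟩ := h.transition_eq hs
  have hlen := hp.length_le
  rw [List.length_append] at hlen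
  have hpos : ∀ i, ∃ p : Fin (w.length + 2), ((p : ℕ) : ℤ) = ((e.pos i : ℕ) : ℤ) + (d i : ℤ) := by
    intro i
    by_cases hr : i = reader hk
    · exact ⟨⟨c'.past.length + 1, by omega⟩, by rw [hr, h.reader_eq]; push_cast; omega⟩
    by_cases hw : i = writer hk
    · exact ⟨⟨c'.past.length + c'.queue.length + 1, by omega⟩, by
        rw [hw, h.writer_eq]; push_cast; omega⟩
    · exact ⟨e.pos i, by simp [h₄ i hr hw]⟩
  choose p hpos using hpos
  have hstep : (toFA hk prog start).Step w e ⟨c'.state, p⟩ :=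
    (step_toFA_iff hk prog start).2 ⟨d, (h₁ _).2 ⟨hp, rfl⟩, hpos⟩
  exact ⟨_, hstep, h.step hs hstep⟩

theorem exists_represents {k : ℕ} {hk : 2 ≤ k} {prog : S → QueueInstr S} {start : S}
    {w : List (Fin 2)} {c : QueueConfig S} (h : Reaches prog ⟨start, [], []⟩ c)
    (hp : c.past ++ c.queue <+: w) :
    ∃ e, Relation.ReflTransGen ((toFA hk prog start).Step w) ((toFA hk prog start).init w) e ∧
      Represents hk e c := by
  induction h with
  | refl => exact ⟨_, .refl, represents_init hk prog start w⟩
  | tail _ h₂ ih =>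
    obtain ⟨e, he, hr⟩ := ih ((past_append_queue_prefix_of_next h₂).trans hp)
    obtain ⟨e', he', hr'⟩ := hr.exists_step (start := start) h₂ hp
    exact ⟨e', he.tail he', hr'⟩

theorem language_toFA_nonempty {k : ℕ} (hk : 2 ≤ k) {prog : S → QueueInstr S} {start : S}
    {c : QueueConfig S} (h : Reaches prog ⟨start, [], []⟩ c) (hc : prog c.state = halt) :
    ∃ w, w ∈ (toFA hk prog start).language := by
  -- The accepted word is the complete history of pushed letters.
  obtain ⟨e, he, hr⟩ := exists_represents (hk := hk) h (List.prefix_refl _)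
  refine ⟨_, e, he, ?_, ?_⟩
  · simpa [toFA, hr.state_eq] using hc
  · simp [MultiHeadFA.Halts, MultiHeadFA.situation, toFA, hr.state_eq, hc, transition]

/-- On an input that the automaton accepts, it follows the queue machine until that halts, unless
the queue machine gets stuck. -/
theorem exists_reaches_of_mem_language {k : ℕ} {hk : 2 ≤ k} {prog : S → QueueInstr S} {start : S}
    (hns : ∀ c, Reaches prog ⟨start, [], []⟩ c → next prog c = none → prog c.state = halt)
    {w : List (Fin 2)} (hw : w ∈ (toFA hk prog start).language) :
    ∃ c, Reaches prog ⟨start, [], []⟩ c ∧ prog c.state = halt ∧ c.past ++ c.queue <+: w := by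
  obtain ⟨e, he, ha, -⟩ := hw
  have key : ∃ c, Reaches prog ⟨start, [], []⟩ c ∧ Represents hk e c := by
    clear ha
    induction he with
    | refl => exact ⟨_, .refl, represents_init hk prog start w⟩
    | tail _ hs ih =>
      obtain ⟨c, hc, hr⟩ := ih
      cases hn : next prog c with
      | none =>
        -- On an empty queue the reader could still scan an unverified input letter; this is why
        -- stuck configurations have to be excluded.
        have := hns c hc hn
        rw [step_toFA_iff, hr.state_eq, this] at hs
        simp [transition] at hs
      | some c' => exact ⟨c', hc.tail hn, hr.step hn hs⟩
  obtain ⟨c, hc, hr⟩ := key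
  refine ⟨c, hc, ?_, hr.isPrefix⟩
  simpa [toFA, hr.state_eq] using ha

end QueueInstr

/-! ### Structured queue programs and their finite control. -/

/-- Structured programs for a queue of letters; `loop p` runs `p` as long as the first letter is
`0`. -/
inductive QueueProg where
  | skip : QueueProg
  | push : Fin 2 → QueueProg
  | pop : QueueProg
  | seq : QueueProg → QueueProg → QueueProg
  | loop : QueueProg → QueueProg

namespace QueueProg

/-- The queue machine whose control states are the lists of programs that remain to be run. -/
def instr : List QueueProg → QueueInstr (List QueueProg)
  | [] => .halt
  | skip :: K => .jump K
  | push x :: K => .push x K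
  | pop :: K => .pop K
  | seq p q :: K => .jump (p :: q :: K)
  | loop p :: K => .test (p :: loop p :: K) K

/-- The control states that are visited when `p` is run before `K`. -/
def continuations : QueueProg → List QueueProg → Set (List QueueProg)
  | skip, K => {skip :: K}
  | push x, K => {push x :: K}
  | pop, K => {pop :: K}
  | seq p q, K => insert (seq p q :: K) (continuations p (q :: K) ∪ continuations q K)
  | loop p, K => insert (loop p :: K) (continuations p (loop p :: K))

theorem finite_continuations (p : QueueProg) (K : List QueueProg) :
    (p.continuations K).Finite := by
  induction p generalizing K with
  | skip | push | pop => exact Set.finite_singleton _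
  | seq p q hp hq => exact ((hp _).union (hq _)).insert _
  | loop p hp => exact (hp _).insert _

theorem cons_mem_continuations (p : QueueProg) (K : List QueueProg) :
    p :: K ∈ p.continuations K := by
  cases p <;> simp [continuations]

end QueueProg

namespace QueueInstr

/-- The control states to which an instruction can lead. -/
def succs {S : Type} : QueueInstr S → Set S
  | halt => ∅
  | jump s => {s}
  | push _ s => {s}
  | pop s => {s}
  | test s s' => {s, s'}

theorem exists_map_eq {S S' : Type} {φ : S → S'} (i : QueueInstr S')
    (h : i.succs ⊆ Set.range φ) : ∃ j : QueueInstr S, j.map φ = i := by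
  cases i with
  | halt => exact ⟨halt, rfl⟩
  | jump s =>
    obtain ⟨t, rfl⟩ := h rfl
    exact ⟨jump t, rfl⟩
  | push x s =>
    obtain ⟨t, rfl⟩ := h rfl
    exact ⟨push x t, rfl⟩
  | pop s =>
    obtain ⟨t, rfl⟩ := h rfl
    exact ⟨pop t, rfl⟩
  | test s s' =>
    obtain ⟨t, rfl⟩ := h (Set.mem_insert _ _)
    obtain ⟨t', rfl⟩ := h (Set.mem_insert_of_mem _ rfl)
    exact ⟨test t t', rfl⟩

end QueueInstr

namespace QueueProg

/-- Closure under successors, with `K` as the only exit, makes the finite set `continuations` usable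
as a control set. -/
theorem succs_instr_subset (p : QueueProg) (K L : List QueueProg) (h : L ∈ p.continuations K) :
    (instr L).succs ⊆ insert K (p.continuations K) := by
  induction p generalizing K L with
  | skip | push | pop =>
    cases h
    simp [instr, QueueInstr.succs]
  | seq p q hp hq =>
    rcases h with rfl | h | h
    · simp [instr, QueueInstr.succs, continuations, cons_mem_continuations]
    · refine (hp _ _ h).trans (Set.insert_subset ?_ ?_)
      · simp [continuations, cons_mem_continuations]
      · intro x hx
        simp [continuations, hx]
    · refine (hq _ _ h).trans (Set.insert_subset_insert ?_)
      intro x hx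
      simp [continuations, hx]
  | loop p hp =>
    rcases h with rfl | h
    · simp [instr, QueueInstr.succs, continuations, cons_mem_continuations, Set.insert_subset_iff]
    · refine (hp _ _ h).trans (Set.insert_subset ?_ ?_)
      · simp [continuations]
      · intro x hx
        simp [continuations, hx]

/-- The queue machine of a single program has finitely many reachable control states. -/
theorem exists_finite_machine (p : QueueProg) :
    ∃ (N : ℕ) (prog : Fin N → QueueInstr (Fin N)) (φ : Fin N → List QueueProg) (s : Fin N),
      (∀ s, (prog s).map φ = instr (φ s)) ∧ φ s = [p] := by
  have hfin : (insert [] (p.continuations [])).Finite := (p.finite_continuations []).insert _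
  have : Finite ↑(insert [] (p.continuations [])) := hfin
  obtain ⟨N, ⟨e⟩⟩ := Finite.exists_equiv_fin ↑(insert [] (p.continuations []))
  have hrange : Set.range (fun i => (e.symm i).1) = insert [] (p.continuations []) := by
    ext L
    constructor
    · rintro ⟨i, rfl⟩
      exact (e.symm i).2
    · intro h
      exact ⟨e ⟨L, h⟩, by simp⟩
  have h : ∀ i : Fin N, ∃ j : QueueInstr (Fin N),
      j.map (fun i => (e.symm i).1) = instr (e.symm i).1 := by
    intro i
    apply QueueInstr.exists_map_eq
    rw [hrange]
    rcases (e.symm i).2 with h | h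
    · rw [h]
      simp [instr, QueueInstr.succs]
    · exact succs_instr_subset p [] _ h
  choose prog hprog using h
  exact ⟨N, prog, _, e ⟨[p], Or.inr (p.cons_mem_continuations [])⟩, hprog, by simp⟩

/-- Running `p` on the queue `u` results in the queue `v`. -/
def Does (p : QueueProg) (u v : List (Fin 2)) : Prop :=
  ∀ K d, ∃ d', QueueInstr.Reaches instr ⟨p :: K, d, u⟩ ⟨K, d', v⟩

theorem reaches_of_next {K K' : List QueueProg} {d d' u u' : List (Fin 2)}
    (h : QueueInstr.next instr ⟨K, d, u⟩ = some ⟨K', d', u'⟩) :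
    QueueInstr.Reaches instr ⟨K, d, u⟩ ⟨K', d', u'⟩ := .single h

theorem does_skip (u : List (Fin 2)) : Does skip u u :=
  fun _ d => ⟨d, reaches_of_next rfl⟩

theorem does_push (x : Fin 2) (u : List (Fin 2)) : Does (push x) u (u ++ [x]) :=
  fun _ d => ⟨d, reaches_of_next rfl⟩

theorem does_pop (x : Fin 2) (u : List (Fin 2)) : Does pop (x :: u) u :=
  fun _ d => ⟨d ++ [x], reaches_of_next rfl⟩

theorem Does.seq {p q : QueueProg} {u v w : List (Fin 2)} (hp : Does p u v) (hq : Does q v w) :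
    Does (seq p q) u w := by
  intro K d
  obtain ⟨d₁, h₁⟩ := hp (q :: K) d
  obtain ⟨d₂, h₂⟩ := hq K d₁
  exact ⟨d₂, .head rfl (h₁.trans h₂)⟩

theorem does_loop_one (p : QueueProg) (u : List (Fin 2)) : Does (loop p) (1 :: u) (1 :: u) :=
  fun _ d => ⟨d, reaches_of_next rfl⟩

theorem Does.loop {p : QueueProg} {u v w : List (Fin 2)} (hp : Does p (0 :: u) v)
    (hl : Does (loop p) v w) : Does (loop p) (0 :: u) w := by
  intro K d
  obtain ⟨d₁, h₁⟩ := hp (.loop p :: K) d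
  obtain ⟨d₂, h₂⟩ := hl K d₁
  exact ⟨d₂, .head rfl (h₁.trans h₂)⟩

/-- A loop whose body can be repeated forever does not halt. -/
theorem next_ne_none_of_loop {p : QueueProg} {u : ℕ → List (Fin 2)}
    (h : ∀ j, ∃ v, u j = 0 :: v ∧ Does p (0 :: v) (u (j + 1))) {K : List QueueProg}
    {d : List (Fin 2)} {c : QueueConfig (List QueueProg)}
    (hc : QueueInstr.Reaches instr ⟨.loop p :: K, d, u 0⟩ c) : QueueInstr.next instr c ≠ none := by
  refine QueueInstr.next_ne_none_of_reaches
    (C := {c | ∃ j d, c = ⟨.loop p :: K, d, u j⟩}) ?_ ⟨0, d, rfl⟩ hc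
  rintro _ ⟨j, d, rfl⟩
  obtain ⟨v, hv, hp⟩ := h j
  obtain ⟨d', hr⟩ := hp (.loop p :: K) d
  refine ⟨⟨p :: .loop p :: K, d, 0 :: v⟩, by rw [hv]; rfl, _, ⟨j + 1, d', rfl⟩, hr⟩

/-! ### Blocks -/

/-- Moves the first block `0 … 0 1` of the queue to its end. -/
def rot : QueueProg := seq (loop (seq pop (push 0))) (seq pop (push 1))

theorem does_rot (n : ℕ) (u : List (Fin 2)) :
    Does rot (List.replicate n 0 ++ 1 :: u) (u ++ (List.replicate n 0 ++ [1])) := by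
  -- The induction needs every `u`, because each transferred `0` is added to the rest of the queue.
  have h : ∀ u, Does (loop (.seq pop (push 0))) (List.replicate n 0 ++ 1 :: u)
      (1 :: (u ++ List.replicate n 0)) := by
    induction n with
    | zero => intro u; simpa using does_loop_one _ _
    | succ n ih =>
      intro u
      refine Does.loop ((does_pop _ _).seq (does_push _ _)) ?_
      have := ih (u ++ [0])
      simpa [List.replicate_succ] using this
  refine (h u).seq ((does_pop _ _).seq ?_)
  rw [← List.append_assoc]
  exact does_push 1 (u ++ List.replicate n 0)

/-- Moves the first `n` blocks of the queue to its end. -/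
def rots : ℕ → QueueProg
  | 0 => skip
  | n + 1 => seq rot (rots n)

/-- The queue that consists of the blocks for the contents of the registers in a list. -/
def enc (σ : ℕ → ℕ) (l : List ℕ) : List (Fin 2) :=
  l.flatMap fun r => List.replicate (σ r) 0 ++ [1]

theorem enc_append (σ : ℕ → ℕ) (l l' : List ℕ) : enc σ (l ++ l') = enc σ l ++ enc σ l' := by
  simp [enc]

theorem enc_cons (σ : ℕ → ℕ) (r : ℕ) (l : List ℕ) :
    enc σ (r :: l) = List.replicate (σ r) 0 ++ 1 :: enc σ l := by
  simp [enc]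

theorem enc_congr {σ τ : ℕ → ℕ} {l : List ℕ} (h : ∀ r ∈ l, σ r = τ r) : enc σ l = enc τ l := by
  induction l with
  | nil => rfl
  | cons r l ih =>
    rw [enc_cons, enc_cons, h r (by simp), ih fun r hr => h r (by simp [hr])]

theorem enc_update {σ : ℕ → ℕ} {l : List ℕ} {r : ℕ} (h : r ∉ l) (x : ℕ) :
    enc (Function.update σ r x) l = enc σ l :=
  enc_congr fun s hs => Function.update_of_ne (by rintro rfl; exact h hs) _ _

theorem does_rots (σ : ℕ → ℕ) (l l' : List ℕ) :
    Does (rots l.length) (enc σ (l ++ l')) (enc σ (l' ++ l)) := by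
  induction l generalizing l' with
  | nil => simpa using! does_skip (enc σ l')
  | cons r l ih =>
    refine Does.seq (v := enc σ (l ++ (l' ++ [r]))) ?_ ?_
    · have := does_rot (σ r) (enc σ (l ++ l'))
      rw [List.cons_append, enc_cons]
      convert this using 1
      simp [enc]
    · convert ih (l' ++ [r]) using 2
      simp

/-! ### Registers -/

/-- On the registers `0, …, m - 1`, the program `p` changes the contents `σ` into `τ`. -/
def Computes (m : ℕ) (p : QueueProg) (σ τ : ℕ → ℕ) : Prop :=
  Does p (enc σ (List.range m)) (enc τ (List.range m))

variable {m : ℕ} {p q : QueueProg} {σ τ ρ : ℕ → ℕ} {r : ℕ}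

theorem Computes.seq (hp : Computes m p σ τ) (hq : Computes m q τ ρ) :
    Computes m (seq p q) σ ρ := Does.seq hp hq

theorem computes_skip (σ : ℕ → ℕ) : Computes m skip σ σ := does_skip _

theorem range_eq (hr : r < m) :
    List.range m = List.range r ++ r :: List.range' (r + 1) (m - r - 1) := by
  rw [List.range_eq_range', List.range_eq_range', show m = r + (m - r - 1 + 1) by omega,
    ← List.range'_append_1, List.range'_succ]
  simp

/-- Adds one to register `r`. -/
def incReg (m r : ℕ) : QueueProg := seq (rots r) (seq (push 0) (seq rot (rots (m - r - 1))))

/-- With block `r` rotated to the front, a `0` is pushed at the end; the block itself is then moved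
behind that `0`, which thereby becomes its additional leading letter. The remaining rotations
restore the order. -/
theorem computes_incReg (hr : r < m) (σ : ℕ → ℕ) :
    Computes m (incReg m r) σ (Function.update σ r (σ r + 1)) := by
  have h₁ : r ∉ List.range r := by simp
  have h₂ : r ∉ List.range' (r + 1) (m - r - 1) := by simp
  have e₁ : (List.range r).length = r := by simp
  have e₂ : (List.range' (r + 1) (m - r - 1)).length = m - r - 1 := by simp
  unfold Computes incReg
  rw [range_eq hr]
  generalize List.range r = l at *
  generalize List.range' (r + 1) (m - r - 1) = l' at *
  rw [← e₂]
  nth_rewrite 1 [← e₁]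
  refine (does_rots σ l (r :: l')).seq ((does_push _ _).seq (Does.seq
    (v := enc (Function.update σ r (σ r + 1)) (l' ++ (l ++ [r]))) ?_ ?_))
  · rw [List.cons_append, enc_cons]
    convert does_rot (σ r) (enc σ (l' ++ l) ++ [0]) using 1
    · simp
    · simp only [enc_append, enc_update h₁, enc_update h₂]
      simp [enc, List.replicate_succ]
  · simpa using does_rots (Function.update σ r (σ r + 1)) l' (l ++ [r])

/-- The body of `loopReg`, with the queue rotated so that register `r` is at the front. -/
def loopBody (m r : ℕ) (p : QueueProg) : QueueProg := seq pop (seq (rots (m - r)) (seq p (rots r)))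

/-- As long as register `r` is not zero, subtracts one from it and runs `p`. -/
def loopReg (m r : ℕ) (p : QueueProg) : QueueProg :=
  seq (rots r) (seq (loop (loopBody m r p)) (rots (m - r)))

/-- The queue rotated so that register `r` is at the front. -/
def rotEnc (m r : ℕ) (σ : ℕ → ℕ) : List (Fin 2) :=
  enc σ (r :: List.range' (r + 1) (m - r - 1) ++ List.range r)

theorem does_rots_rotEnc (hr : r < m) (σ : ℕ → ℕ) :
    Does (rots r) (enc σ (List.range m)) (rotEnc m r σ) := by
  have := does_rots σ (List.range r) (r :: List.range' (r + 1) (m - r - 1))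
  rwa [← range_eq hr, List.length_range] at this

theorem rotEnc_does_rots (hr : r < m) (σ : ℕ → ℕ) :
    Does (rots (m - r)) (rotEnc m r σ) (enc σ (List.range m)) := by
  have := does_rots σ (r :: List.range' (r + 1) (m - r - 1)) (List.range r)
  rw [← range_eq hr, List.length_cons, List.length_range'] at this
  rwa [show m - r = m - r - 1 + 1 by omega]

/-- A leading `0` signals a nonzero register, and removing it is a decrement; so `loop` and `pop`
act on the register in front. -/
theorem rotEnc_eq_cons {x : ℕ} (h : σ r = x + 1) :
    rotEnc m r σ = 0 :: rotEnc m r (Function.update σ r x) := by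
  have h₁ : r ∉ List.range' (r + 1) (m - r - 1) ++ List.range r := by simp
  simp only [rotEnc, List.cons_append, enc_cons, h, enc_update h₁, Function.update_self,
    List.replicate_succ]

theorem does_loopBody (hr : r < m) {x : ℕ} (h : σ r = x + 1)
    (hp : Computes m p (Function.update σ r x) τ) :
    Does (loopBody m r p) (rotEnc m r σ) (rotEnc m r τ) := by
  rw [rotEnc_eq_cons h]
  exact (does_pop _ _).seq ((rotEnc_does_rots hr _).seq (Does.seq hp (does_rots_rotEnc hr _)))

/-- Here `s j` is the content of the registers before round `j`; the body may itself change register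
`r`, so the number of rounds is not tied to its initial value. -/
theorem computes_loopReg (hr : r < m) (n : ℕ) (s : ℕ → ℕ → ℕ)
    (h : ∀ j < n, ∃ x, s j r = x + 1 ∧ Computes m p (Function.update (s j) r x) (s (j + 1)))
    (hn : s n r = 0) : Computes m (loopReg m r p) (s 0) (s n) := by
  refine (does_rots_rotEnc hr _).seq (Does.seq ?_ (rotEnc_does_rots hr _))
  induction n generalizing s with
  | zero =>
    simp only [rotEnc, List.cons_append, enc_cons, hn]
    exact does_loop_one _ _
  | succ n ih =>
    obtain ⟨x, hx, hp⟩ := h 0 (by omega)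
    have h₁ := does_loopBody hr hx hp
    have h₂ := ih (fun j => s (j + 1)) (fun j hj => h (j + 1) (by omega)) hn
    rw [rotEnc_eq_cons hx] at h₁ ⊢
    exact h₁.loop h₂

/-- The intermediate configuration `c` is the entry to the loop, after the initial rotation. -/
theorem next_ne_none_of_loopReg (hr : r < m) (s : ℕ → ℕ → ℕ)
    (h : ∀ j, ∃ x, s j r = x + 1 ∧ Computes m p (Function.update (s j) r x) (s (j + 1)))
    {K : List QueueProg} {d : List (Fin 2)} :
    ∃ c, QueueInstr.Reaches instr ⟨loopReg m r p :: K, d, enc (s 0) (List.range m)⟩ c ∧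
      ∀ c', QueueInstr.Reaches instr c c' → QueueInstr.next instr c' ≠ none := by
  obtain ⟨d', h'⟩ := does_rots_rotEnc hr (s 0) (seq (loop (loopBody m r p)) (rots (m - r)) :: K) d
  refine ⟨⟨loop (loopBody m r p) :: rots (m - r) :: K, d', rotEnc m r (s 0)⟩,
    .head rfl (h'.tail rfl), fun c' hc' => ?_⟩
  refine next_ne_none_of_loop (u := fun j => rotEnc m r (s j)) (fun j => ?_) hc'
  obtain ⟨x, hx, hp⟩ := h j
  refine ⟨_, rotEnc_eq_cons hx, ?_⟩
  rw [← rotEnc_eq_cons hx]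
  exact does_loopBody hr hx hp

end QueueProg

/-! ### Register programs for primitive recursive functions. -/

namespace QueueProg

open Filter

variable {m : ℕ} {p q : QueueProg} {σ τ : ℕ → ℕ} {r : ℕ}

theorem Computes.congr_right {τ' : ℕ → ℕ} (h : Computes m p σ τ) (e : ∀ i, τ i = τ' i) :
    Computes m p σ τ' := by
  rwa [← funext e]

theorem Computes.congr_left {σ' : ℕ → ℕ} (h : Computes m p σ τ) (e : ∀ i, σ i = σ' i) :
    Computes m p σ' τ := by
  rwa [← funext e]

theorem computes_clear (hr : r < m) (σ : ℕ → ℕ) :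
    Computes m (loopReg m r skip) σ (Function.update σ r 0) := by
  have := computes_loopReg (p := skip) hr (σ r) (fun j => Function.update σ r (σ r - j))
    (fun j hj => ⟨σ r - j - 1, by simp; omega, ?_⟩) (by simp)
  · simpa using this
  · refine (computes_skip _).congr_right fun i => ?_
    simp only [Function.update_apply]
    grind

theorem computes_move {o : ℕ} (hr : r < m) (ho : o < m) (hro : r ≠ o) (σ : ℕ → ℕ) :
    Computes m (loopReg m r (incReg m o)) σ
      (Function.update (Function.update σ r 0) o (σ o + σ r)) := by
  have := computes_loopReg (p := incReg m o) hr (σ r)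
    (fun j => Function.update (Function.update σ r (σ r - j)) o (σ o + j))
    (fun j hj => ⟨σ r - j - 1, by simp [hro]; omega, ?_⟩) (by simp [hro])
  · simpa using this
  · refine (computes_incReg ho _).congr_right fun i => ?_
    simp only [Function.update_apply]
    grind

/-- Adds register `x` to register `o`, with the help of the empty register `t`. -/
def copyReg (m x o t : ℕ) : QueueProg :=
  seq (loopReg m x (seq (incReg m t) (incReg m o))) (loopReg m t (incReg m x))

theorem computes_copyReg {x o t : ℕ} (hx : x < m) (ho : o < m) (ht : t < m) (hxo : x ≠ o)
    (hxt : x ≠ t) (hot : o ≠ t) (σ : ℕ → ℕ) (h : σ t = 0) :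
    Computes m (copyReg m x o t) σ (Function.update σ o (σ o + σ x)) := by
  -- The first loop destroys `x` while counting it into both `t` and `o`; the second one moves `t`
  -- back to `x`.
  have h₁ := computes_loopReg (p := seq (incReg m t) (incReg m o)) hx (σ x)
    (fun j => Function.update (Function.update (Function.update σ x (σ x - j)) t j) o (σ o + j))
    (fun j hj => ⟨σ x - j - 1, by simp [hxo, hxt]; omega, ?_⟩) (by simp [hxo, hxt])
  · refine h₁.congr_left (fun i => ?_) |>.seq
      ((computes_move ht hx hxt.symm _).congr_right fun i => ?_)
    all_goals
      simp only [Function.update_apply]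
      grind
  · refine ((computes_incReg ht _).seq (computes_incReg ho _)).congr_right fun i => ?_
    simp only [Function.update_apply]
    grind

/-- The programs `p 0, …, p (n - 1)` one after the other. -/
def seqs (p : ℕ → QueueProg) : ℕ → QueueProg
  | 0 => skip
  | n + 1 => seq (seqs p n) (p n)

theorem computes_seqs {p : ℕ → QueueProg} {s : ℕ → ℕ → ℕ} {n : ℕ}
    (h : ∀ j < n, Computes m (p j) (s j) (s (j + 1))) : Computes m (seqs p n) (s 0) (s n) := by
  induction n with
  | zero => exact computes_skip _
  | succ n ih => exact (ih fun j hj => h j (by omega)).seq (h n (by omega))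

/-- For all large numbers `m` of registers there is a program that adds the value of `f` at the
contents of the registers `ins` to register `o`, provided that the registers from `b` on are empty;
no other register is changed. -/
def AddsValue {n : ℕ} (f : List.Vector ℕ n → ℕ) (ins : Fin n → ℕ) (o b : ℕ) : Prop :=
  ∀ᶠ m in atTop, ∃ p, ∀ σ : ℕ → ℕ, (∀ r ≥ b, σ r = 0) →
    Computes m p σ (Function.update σ o (σ o + f (List.Vector.ofFn fun i => σ (ins i))))

/-- The registers `b, …, b + n - 1` hold the values of the `g i`; scratch space for the parts starts
at `b + n`. Clearing the held values restores the invariant. The number `m` of registers enters the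
program code, so it is left to be any large number on which all parts agree. -/
theorem AddsValue.comp {n k : ℕ} {f : List.Vector ℕ n → ℕ} {g : Fin n → List.Vector ℕ k → ℕ}
    {ins : Fin k → ℕ} {o b : ℕ} (hins : ∀ i, ins i < b) (ho : o < b)
    (hf : AddsValue f (fun i => b + i) o (b + n))
    (hg : ∀ i : Fin n, AddsValue (g i) ins (b + i) (b + n)) :
    AddsValue (fun a => f (List.Vector.ofFn fun i => g i a)) ins o b := by
  filter_upwards [hf, eventually_all.2 hg, eventually_ge_atTop (b + n)] with m hf hg hm
  obtain ⟨pf, hpf⟩ := hf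
  choose pg hpg using hg
  refine ⟨seq (seqs (fun j => if h : j < n then pg ⟨j, h⟩ else skip) n)
    (seq pf (seqs (fun j => loopReg m (b + j) skip) n)), fun σ hσ => ?_⟩
  set v := List.Vector.ofFn fun i => σ (ins i) with hv
  set G : ℕ → ℕ := fun j => if h : j < n then g ⟨j, h⟩ v else 0 with hG
  -- State `j`: the first `j` values have been stored.
  have h₁ := computes_seqs (m := m) (p := fun j => if h : j < n then pg ⟨j, h⟩ else skip)
    (s := fun j r => if b ≤ r ∧ r < b + j then G (r - b) else σ r) (n := n) (by
      intro j hj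
      simp only [hj, dif_pos]
      refine (hpg ⟨j, hj⟩ _ fun r hr => ?_).congr_right fun r => ?_
      · rw [if_neg (by omega), hσ r (by omega)]
      · have : (fun i => if b ≤ ins i ∧ ins i < b + j then G (ins i - b) else σ (ins i)) =
            fun i => σ (ins i) := by
          funext i
          rw [if_neg (by have := hins i; omega)]
        rw [this, ← hv]
        have hGj : G j = g ⟨j, hj⟩ v := by simp [hG, hj]
        have := hσ (b + j) (by omega)
        simp only [Function.update_apply]
        grind)
  have h₂ := hpf _ (fun r hr => show (if b ≤ r ∧ r < b + n then G (r - b) else σ r) = 0 by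
    rw [if_neg (by omega), hσ r (by omega)])
  -- State `j`: the result has been added and the first `j` stored values have been cleared.
  have h₃ := computes_seqs (m := m) (p := fun j => loopReg m (b + j) skip)
    (s := fun j r => if b + j ≤ r ∧ r < b + n then G (r - b) else
      Function.update σ o (σ o + f (List.Vector.ofFn fun i => g i v)) r) (n := n) (by
      intro j hj
      refine (computes_clear (by omega) _).congr_right fun r => ?_
      have := hσ (b + j) (by omega)
      simp only [Function.update_apply]
      grind)
  refine (h₁.congr_left fun r => ?_).seq ((h₂.congr_right fun r => ?_).seq
    (h₃.congr_right fun r => ?_))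
  · simp
  · have : (fun i : Fin n => if b ≤ b + (i : ℕ) ∧ b + (i : ℕ) < b + n then G (b + i - b)
        else σ (b + i)) = fun i => g i v := by
      funext i
      simp [hG]
    simp only [this]
    simp only [Function.update_apply]
    grind
  · simp only [Function.update_apply]
    grind

/-- Register `b` counts the remaining rounds, `b + 1` holds the recursion index, `b + 2` the current
value, and `b + 3` receives the next value before it replaces the old one. -/
theorem AddsValue.prec {n : ℕ} {f : List.Vector ℕ n → ℕ} {g : List.Vector ℕ (n + 2) → ℕ}
    {ins : Fin (n + 1) → ℕ} {o b : ℕ} (hins : ∀ i, ins i < b) (ho : o < b) (hio : ∀ i, ins i ≠ o)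
    (hf : AddsValue f (fun i => ins i.succ) (b + 2) (b + 4))
    (hg : AddsValue g (Fin.cons (b + 1) (Fin.cons (b + 2) fun i => ins i.succ)) (b + 3)
      (b + 4)) :
    AddsValue (fun v : List.Vector ℕ (n + 1) =>
      v.head.rec (f v.tail) fun y IH => g (y ::ᵥ IH ::ᵥ v.tail)) ins o b := by
  filter_upwards [hf, hg, eventually_ge_atTop (b + 4)] with m hf hg hm
  obtain ⟨pf, hpf⟩ := hf
  obtain ⟨pg, hpg⟩ := hg
  refine ⟨seq (copyReg m (ins 0) b (b + 1)) (seq pf (seq (loopReg m b (seq pg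
    (seq (loopReg m (b + 2) skip) (seq (loopReg m (b + 3) (incReg m (b + 2)))
      (incReg m (b + 1)))))) (seq (loopReg m (b + 2) (incReg m o)) (loopReg m (b + 1) skip)))),
    fun σ hσ => ?_⟩
  set x := σ (ins 0) with hx
  set w := List.Vector.ofFn (fun i : Fin n => σ (ins i.succ)) with hw
  set R : ℕ → ℕ := fun j => j.rec (f w) fun y IH => g (y ::ᵥ IH ::ᵥ w) with hR
  have hgoal : (List.Vector.ofFn fun i => σ (ins i)).head.rec
      (f (List.Vector.ofFn fun i => σ (ins i)).tail)
      (fun y IH => g (y ::ᵥ IH ::ᵥ (List.Vector.ofFn fun i => σ (ins i)).tail)) = R x := rfl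
  rw [hgoal]
  have hins₀ := hins 0
  have hio₀ := hio 0
  have hs₀ := hσ b (by omega)
  have hs₁ := hσ (b + 1) (by omega)
  have hs₂ := hσ (b + 2) (by omega)
  have hs₃ := hσ (b + 3) (by omega)
  have hstep : ∀ j, R (j + 1) = g (j ::ᵥ R j ::ᵥ w) := fun _ => rfl
  set s : ℕ → ℕ → ℕ := fun j => Function.update (Function.update (Function.update σ b (x - j))
    (b + 1) j) (b + 2) (R j) with hs
  have h₁ := computes_copyReg (m := m) (x := ins 0) (o := b) (t := b + 1) (by omega) (by omega)
    (by omega) (by omega) (by omega) (by omega) σ hs₁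
  have h₂ := hpf (Function.update σ b (σ b + σ (ins 0))) (fun r hr => by
    rw [Function.update_of_ne (by omega), hσ r (by omega)])
  have h₃ := computes_loopReg (m := m) (r := b) (by omega) x s (p := seq pg
    (seq (loopReg m (b + 2) skip) (seq (loopReg m (b + 3) (incReg m (b + 2)))
      (incReg m (b + 1))))) (fun j hj => ⟨x - j - 1, ?_, ?_⟩) (by simp [hs])
  · have h₄ := computes_move (m := m) (r := b + 2) (o := o) (by omega) (by omega) (by omega) (s x)
    have h₅ := computes_clear (m := m) (r := b + 1) (by omega)
      (Function.update (Function.update (s x) (b + 2) 0) o (s x o + s x (b + 2)))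
    refine h₁.seq ((h₂.congr_right fun r => ?_).seq (h₃.seq (h₄.seq (h₅.congr_right fun r => ?_))))
    · have hin : (fun i : Fin n => Function.update σ b (σ b + σ (ins 0)) (ins i.succ)) =
          fun i => σ (ins i.succ) := by
        funext i
        rw [Function.update_of_ne]
        have := hins i.succ
        omega
      have hR₀ : R 0 = f w := rfl
      rw [hin, ← hw, ← hR₀]
      simp only [hs, Function.update_apply]
      grind
    · simp only [hs, Function.update_apply]
      grind
  · simp [hs]
    omega
  · have h₄ := hpg (Function.update (s j) b (x - j - 1)) (fun r hr => by
      simp only [hs, Function.update_apply]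
      have := hσ r (by omega)
      grind)
    have hin : (List.Vector.ofFn fun i => Function.update (s j) b (x - j - 1)
        (Fin.cons (α := fun _ => ℕ) (b + 1) (Fin.cons (α := fun _ => ℕ) (b + 2)
          fun i => ins i.succ) i)) = j ::ᵥ R j ::ᵥ w := by
      have h₁ : Function.update (s j) b (x - j - 1) (b + 1) = j := by simp [hs]
      have h₂ : Function.update (s j) b (x - j - 1) (b + 2) = R j := by simp [hs]
      have h₃ : ∀ i : Fin n, Function.update (s j) b (x - j - 1) (ins i.succ) = σ (ins i.succ) := by
        intro i
        have := hins i.succ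
        simp only [hs, Function.update_apply]
        grind
      simp only [List.Vector.ofFn, Fin.cons_zero, Fin.cons_succ, h₁, h₂, h₃, hw]
    rw [hin, ← hstep] at h₄
    refine h₄.seq ((computes_clear (by omega) _).seq ((computes_move (by omega) (by omega)
      (by omega) _).seq ((computes_incReg (by omega) _).congr_right fun r => ?_)))
    simp only [hs, Function.update_apply]
    grind

/-- Inputs differ from `o` because copying a register needs a distinct target; the bound `b`
separates them from scratch space. -/
theorem addsValue_of_primrec' {n : ℕ} {f : List.Vector ℕ n → ℕ} (hf : Nat.Primrec' f)
    (ins : Fin n → ℕ) (o b : ℕ) (hins : ∀ i, ins i < b) (ho : o < b) (hio : ∀ i, ins i ≠ o) :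
    AddsValue f ins o b := by
  induction hf generalizing o b with
  | zero => exact .of_forall fun m => ⟨skip, fun σ _ => by simpa using computes_skip σ⟩
  | succ =>
    filter_upwards [eventually_ge_atTop (b + 1)] with m hm
    refine ⟨seq (copyReg m (ins 0) o b) (incReg m o), fun σ hσ => ?_⟩
    have h₀ := hins 0
    refine (computes_copyReg (by omega) (by omega) (by omega) (hio 0) (by omega) (by omega) σ
      (hσ b le_rfl)).seq ((computes_incReg (by omega) _).congr_right fun r => ?_)
    simp [Function.update_apply, List.Vector.ofFn]
    grind
  | get i =>
    filter_upwards [eventually_ge_atTop (b + 1)] with m hm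
    refine ⟨copyReg m (ins i) o b, fun σ hσ => ?_⟩
    have h₀ := hins i
    refine (computes_copyReg (by omega) (by omega) (by omega) (hio i) (by omega) (by omega) σ
      (hσ b le_rfl)).congr_right fun r => ?_
    simp
  | comp g _ _ ihf ihg =>
    refine .comp hins ho (ihf _ _ _ ?_ ?_ ?_) fun i => ihg i _ _ _ ?_ ?_ ?_
    · intro i; simp
    · omega
    · intro i; omega
    · intro j; have := hins j; omega
    · simp
    · intro j; have := hins j; omega
  | prec _ _ ihf ihg =>
    refine .prec hins ho hio (ihf _ _ _ ?_ ?_ ?_) (ihg _ _ _ ?_ ?_ ?_)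
    · intro i; have := hins i.succ; omega
    · omega
    · intro i; have := hins i.succ; omega
    · refine Fin.cases (by simp) (Fin.cases (by simp) fun i => ?_)
      have := hins i.succ
      simp only [Fin.cons_succ]
      omega
    · omega
    · refine Fin.cases (by simp) (Fin.cases (by simp) fun i => ?_)
      have := hins i.succ
      simp only [Fin.cons_succ]
      omega

end QueueProg

/-! ### Unbounded search. -/

namespace QueueProg

/-- A program that, started with `n` letters `0` in the queue, searches for a zero of `g n`. -/
theorem exists_search_program {g : ℕ → ℕ → ℕ} (hg : Primrec₂ g) (hg₁ : ∀ n y, g n y ≤ 1) :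
    ∃ p : QueueProg, ∀ n, ∃ c,
      QueueInstr.Reaches instr ⟨List.replicate n (push 0) ++ [p], [], []⟩ c ∧
      c.past ++ c.queue = List.replicate n 0 ++ [1] ∧
      ((∃ y, g n y = 0) → ∃ c', QueueInstr.Reaches instr c c' ∧ instr c'.state = .halt) ∧
      ((∀ y, g n y ≠ 0) → ∃ c', QueueInstr.Reaches instr c c' ∧
        ∀ c'', QueueInstr.Reaches instr c' c'' → QueueInstr.next instr c'' ≠ none) := by
  obtain ⟨m, ⟨pg, hpg⟩, hm⟩ := ((addsValue_of_primrec' (Nat.Primrec'.prim_iff₂.2 hg) Fin.val 2 3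
    (fun i => by omega) (by omega) (fun i => by omega)).and (Filter.eventually_ge_atTop 3)).exists
  -- The first `1` closes the block of register `0`, which thus contains `n`; the other `m - 1` ones
  -- are empty registers. Register `1` holds the candidate `y`, and register `2` controls the loop.
  refine ⟨seq (push 1) (seq (seq (seqs (fun _ => push 1) (m - 1)) (incReg m 2))
    (loopReg m 2 (seq pg (incReg m 1)))), fun n => ?_⟩
  have hpush : ∀ n K d u, QueueInstr.Reaches instr ⟨List.replicate n (push 0) ++ K, d, u⟩
      ⟨K, d, u ++ List.replicate n 0⟩ := by
    intro n K d
    induction n with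
    | zero => intro u; simpa using .refl
    | succ n ih =>
      intro u
      refine .head rfl ?_
      have := ih (u ++ [0])
      rw [List.append_assoc] at this
      exact this
  have hones : ∀ n u, Does (seqs (fun _ => push 1) n) u (u ++ List.replicate n 1) := by
    intro n u
    induction n with
    | zero => simpa using! does_skip u
    | succ n ih =>
      rw [List.replicate_succ', ← List.append_assoc]
      exact ih.seq (does_push _ _)
  refine ⟨_, (hpush n _ _ _).trans (.head rfl (.head rfl .refl)), by simp, ?_⟩
  -- The value `1` at `j = 0` forces the first round; later, register `2` holds `g n (j - 1)`, the
  -- result of the preceding round.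
  set s : ℕ → ℕ → ℕ := fun j => Function.update (Function.update (Function.update 0 0 n) 1 j) 2
    (if j = 0 then 1 else g n (j - 1)) with hs
  have hstart : Does (seq (seqs (fun _ => push 1) (m - 1)) (incReg m 2))
      (List.replicate n 0 ++ [1]) (enc (s 0) (List.range m)) := by
    refine (hones _ _).seq ?_
    have henc : List.replicate n 0 ++ [1] ++ List.replicate (m - 1) 1 =
        enc (Function.update 0 0 n) (List.range m) := by
      rw [range_eq (r := 0) (by omega), List.range_zero, List.nil_append, enc_cons,
        enc_update (by simp)]
      have hz : ∀ l, enc 0 l = List.replicate l.length 1 := by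
        intro l
        induction l with
        | nil => rfl
        | cons r l ih => simp [enc_cons, ih, List.replicate_succ]
      simp [hz]
    rw [henc]
    refine (computes_incReg (by omega) _).congr_right fun i => ?_
    simp only [hs, Function.update_apply, Pi.zero_apply]
    grind
  have hbody : ∀ j, Computes m (seq pg (incReg m 1)) (Function.update (s j) 2 0) (s (j + 1)) := by
    intro j
    have h₁ := hpg (Function.update (s j) 2 0) (fun r hr => by
      simp only [hs, Function.update_apply, Pi.zero_apply]
      grind)
    refine h₁.seq ((computes_incReg (by omega) _).congr_right fun i => ?_)
    have : g (List.Vector.ofFn fun i : Fin 2 => Function.update (s j) 2 0 i.val).head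
        (List.Vector.ofFn fun i : Fin 2 => Function.update (s j) 2 0 i.val).tail.head = g n j := by
      simp [hs, List.Vector.ofFn]
    simp only [this]
    simp only [hs, Function.update_apply, Pi.zero_apply]
    grind
  -- As `g` is at most `1`, the decrement on entering a round empties register `2`, as adding the
  -- next value of `g` requires.
  have hdec : ∀ j, (∀ y < j, g n y ≠ 0) → s j 2 = 0 + 1 := by
    intro j hj
    rcases j with _ | j
    · simp [hs]
    · have := hj j (by omega)
      have := hg₁ n j
      simp [hs]
      omega
  obtain ⟨d, hd⟩ := hstart [loopReg m 2 (seq pg (incReg m 1))] []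
  refine ⟨?_, fun h => ?_⟩
  · intro h
    classical
    have hz := Nat.find_spec h
    have hm := fun y => Nat.find_min h (m := y)
    generalize Nat.find h = y at hz hm
    have hl := computes_loopReg (m := m) (r := 2) (by omega) (y + 1) s
      (fun j hj => ⟨0, hdec j fun y' hy' => hm y' (by omega), hbody j⟩) (by simp [hs, hz])
    obtain ⟨d', hd'⟩ := hl [] d
    exact ⟨_, .head rfl (hd.trans hd'), rfl⟩
  · obtain ⟨c, hc, hn⟩ := next_ne_none_of_loopReg (m := m) (r := 2) (by omega) s
      (fun j => ⟨0, hdec j fun y _ => h y, hbody j⟩) (K := []) (d := d)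
    exact ⟨c, .head rfl (hd.trans hc), hn⟩

end QueueProg

/-! ### The parameter as a chain of pushing states, and computable descriptions. -/

namespace QueueInstr

theorem transition_map {S S' : Type} (φ : S → S') {k : ℕ} (hk : 2 ≤ k)
    (a : Fin k → TapeSymbol (Fin 2)) (i : QueueInstr S) :
    (i.map φ).transition hk a = (i.transition hk a).map fun t => (φ t.1, t.2) := by
  cases i with
  | halt => rfl
  | jump s => rfl
  | push x s =>
    simp only [map, transition]
    cases a (writer hk) with
    | letter y => by_cases h : y = x <;> simp [h]
    | _ => rfl
  | pop s =>
    simp only [map, transition]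
    cases a (reader hk) <;> rfl
  | test s s' =>
    simp only [map, transition]
    cases a (reader hk) <;> simp [apply_ite]

/-- The state before which a chain of states is inserted: the states `N, N + 1, …` lead to `s` one
after the other. -/
def chainNext (N s i : ℕ) : ℕ := if i = N then s else i - 1

theorem chainNext_lt {N n s i : ℕ} (hs : s < N) (hi : i ≤ N + n) (_ : N ≤ i) :
    chainNext N s i < N + n := by
  unfold chainNext
  split <;> omega

/-- The machine that first adds `n` letters `0` to the queue and then runs `prog` from state `s`. -/
def withPushes {N : ℕ} (prog : Fin N → QueueInstr (Fin N)) (s : Fin N) (n : ℕ) (i : Fin (N + n)) :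
    QueueInstr (Fin (N + n)) :=
  if h : i.val < N then (prog ⟨i, h⟩).map (Fin.castAdd n)
  else push 0 ⟨chainNext N s i, chainNext_lt s.isLt i.isLt.le (by omega)⟩

/-- The initial state of the machine `withPushes prog s n`. -/
def pushesStart {N : ℕ} (s : Fin N) (n : ℕ) : Fin (N + n) :=
  ⟨chainNext N s (N + n), chainNext_lt s.isLt le_rfl (by omega)⟩

theorem map_map {S S' S'' : Type} (φ : S → S') (ψ : S' → S'') (i : QueueInstr S) :
    (i.map φ).map ψ = i.map fun s => ψ (φ s) := by
  cases i <;> rfl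

open QueueProg in
/-- The states of `withPushes prog s n` as lists of programs that remain to be run. -/
theorem exists_map_withPushes {N : ℕ} {prog : Fin N → QueueInstr (Fin N)} {s : Fin N}
    {φ : Fin N → List QueueProg} {p : QueueProg} (h : ∀ i, (prog i).map φ = instr (φ i))
    (hs : φ s = [p]) (n : ℕ) : ∃ ψ : Fin (N + n) → List QueueProg,
      (∀ i, (withPushes prog s n i).map ψ = instr (ψ i)) ∧
      ψ (pushesStart s n) = List.replicate n (QueueProg.push 0) ++ [p] := by
  set ψ : Fin (N + n) → List QueueProg := fun i => if h : i.val < N then φ ⟨i, h⟩ else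
    List.replicate (i - N + 1) (QueueProg.push 0) ++ [p] with hψ
  have hnext : ∀ (i : ℕ) (hi : i ≤ N + n) (hN : N ≤ i),
      ψ ⟨chainNext N s i, chainNext_lt s.isLt hi hN⟩ =
        List.replicate (i - N) (QueueProg.push 0) ++ [p] := by
    intro i hi hN
    by_cases h' : i = N
    · simp [hψ, chainNext, h', hs]
    · have h₁ : ¬ i - 1 < N := by omega
      have h₂ : i - 1 - N + 1 = i - N := by omega
      simp [hψ, chainNext, h', h₁, h₂]
  refine ⟨ψ, fun i => ?_, ?_⟩
  · by_cases hi : i.val < N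
    · have : ∀ j, ψ (Fin.castAdd n j) = φ j := fun j => by simp [hψ]
      simp only [withPushes, hi, dif_pos, map_map, this, h]
      simp [hψ, hi]
    · simp only [withPushes, hi, dif_neg, not_false_eq_true, map]
      rw [hnext _ i.isLt.le (by omega)]
      simp [hψ, hi, List.replicate_succ, instr]
  · rw [pushesStart, hnext _ le_rfl (by omega)]
    simp

end QueueInstr

instance {A : Type*} [Finite A] : Finite (TapeSymbol A) :=
  Finite.of_injective (β := Option (Option A))
    (fun | .leftEnd => none | .rightEnd => some none | .letter a => some (some a))
    (by rintro (_ | _ | _) (_ | _ | _) <;> simp)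

namespace MultiHeadCode

open QueueInstr

theorem exists_list_of_finite {α : Type*} {s : Set α} (h : s.Finite) :
    ∃ l : List α, ∀ x, x ∈ l ↔ x ∈ s :=
  ⟨h.toFinset.toList, by simp⟩

/-- Descriptions of the automata of the machines `withPushes prog s n` can be computed. -/
theorem exists_computable_description {k : ℕ} (hk : 2 ≤ k) {N : ℕ}
    (prog : Fin N → QueueInstr (Fin N)) (s : Fin N) :
    ∃ c : ℕ → MultiHeadCode k, Computable c ∧
      ∀ n, (c n).Describes (toFA hk (withPushes prog s n) (pushesStart s n)) := by
  -- The lists `acc`, `T` and `P` do not depend on `n`, so they enter the computation as constants;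
  -- only the rows of the chain vary. `P` lists the arguments in which the writer scans `0`.
  obtain ⟨acc, hacc⟩ := exists_list_of_finite
    (s := Set.range fun q : {q // prog q = halt} => q.1.val) (Set.finite_range _)
  obtain ⟨T, hT⟩ := exists_list_of_finite
    (s := Set.range fun x : {x : Fin N × (Fin k → TapeSymbol (Fin 2)) × Fin N × (Fin k → SignType) //
      (prog x.1).transition hk x.2.1 = some x.2.2} =>
        (argCode x.1.1 x.1.2.1, [targetCode x.1.2.2])) (Set.finite_range _)
  obtain ⟨P, hP⟩ := exists_list_of_finite
    (s := Set.range fun a : {a : Fin k → TapeSymbol (Fin 2) // a (writer hk) = .letter 0} =>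
      fun i => symbolCode (a.1 i)) (Set.finite_range _)
  set mv : Fin k → ℕ := fun i => moveCode (advance (writer hk) i)
  refine ⟨fun n => (equivTuple k).symm (N + n, 2, chainNext N s (N + n), acc,
    T ++ (List.range n).flatMap fun i => P.map fun x => ((N + i, x), [(chainNext N s (N + i), mv)])),
    ?_, fun n => ?_⟩
  · have hadd : Primrec fun i => N + i := Primrec.nat_add.comp (.const N) .id
    have hnext : Primrec fun i => chainNext N s (N + i) :=
      Primrec.ite (Primrec.eq.comp hadd (.const N)) (.const _) (Primrec.pred.comp hadd)
    refine (Primrec.of_equiv_symm.comp (hadd.pair ((Primrec.const 2).pair (hnext.pair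
      ((Primrec.const acc).pair (Primrec.list_append.comp (.const T) ?_)))))).to_comp
    refine Primrec.list_flatMap Primrec.list_range (Primrec.to₂ (Primrec.list_map (f := fun _ : ℕ × ℕ => P)
      (g := fun x y => ((N + x.2, y), [(chainNext N s (N + x.2), mv)])) (.const P) ?_))
    have hi : Primrec fun z : (ℕ × ℕ) × (Fin k → ℕ) => z.1.2 := Primrec.snd.comp .fst
    exact Primrec.to₂ (((hadd.comp hi).pair .snd).pair
      (Primrec.list_cons.comp ((hnext.comp hi).pair (.const mv)) (.const [])))
  · refine ⟨rfl, rfl, rfl, fun x => ?_, fun e he => ?_, fun q a U hU => ?_⟩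
    · change x ∈ acc ↔ _
      rw [hacc]
      constructor
      · rintro ⟨⟨q, hq⟩, rfl⟩
        refine ⟨Fin.castAdd n q, ?_, rfl⟩
        simp [toFA, withPushes, hq, QueueInstr.map]
      · rintro ⟨q, hq, rfl⟩
        simp only [toFA, withPushes, Set.mem_ofPred_eq] at hq
        split at hq
        · next hlt =>
          refine ⟨⟨⟨q, hlt⟩, ?_⟩, rfl⟩
          generalize prog ⟨q, hlt⟩ = i at hq ⊢
          cases i <;> simp_all [QueueInstr.map]
        · cases hq
    · rcases List.mem_append.1 he with he | he
      · obtain ⟨⟨⟨q, a, t⟩, ht⟩, rfl⟩ := (hT _).1 he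
        refine ⟨Fin.castAdd n q, a, {(Fin.castAdd n t.1, t.2)}, rfl, ?_, fun x => ?_⟩
        · simp only at ht
          simp [toFA, withPushes, transition_map, ht]
        · simp [targetCode]
      · simp only [List.mem_flatMap, List.mem_range, List.mem_map] at he
        obtain ⟨i, hi, x, hx, rfl⟩ := he
        obtain ⟨⟨a, ha⟩, rfl⟩ := (hP _).1 hx
        refine ⟨⟨N + i, by omega⟩, a, {(⟨chainNext N s (N + i),
          chainNext_lt s.isLt (by omega) (by omega)⟩, advance (writer hk))}, rfl, ?_, fun x => ?_⟩
        · simp [toFA, withPushes, transition, ha]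
        · simp [targetCode, mv]
    · simp only [toFA, Option.map_eq_some_iff] at hU
      obtain ⟨t, ht, rfl⟩ := hU
      by_cases hq : q.val < N
      · simp only [withPushes, hq, dif_pos, transition_map, Option.map_eq_some_iff] at ht
        obtain ⟨t', ht', rfl⟩ := ht
        exact ⟨_, List.mem_append_left _ ((hT _).2 ⟨⟨⟨⟨q, hq⟩, a, t'⟩, ht'⟩, rfl⟩), rfl⟩
      · simp only [withPushes, hq, dif_neg, not_false_eq_true, transition] at ht
        have ha : a (writer hk) = .letter 0 := by
          cases h : a (writer hk) with
          | letter y =>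
            rw [h] at ht
            by_cases hy : y = 0
            · rw [hy]
            · simp [hy] at ht
          | _ => simp [h] at ht
        refine ⟨_, List.mem_append_right _ (List.mem_flatMap.2 ⟨q - N, by simp; omega,
          List.mem_map.2 ⟨_, (hP _).2 ⟨⟨a, ha⟩, rfl⟩, rfl⟩⟩), ?_⟩
        simp only [argCode, Prod.mk.injEq, and_true]
        omega

end MultiHeadCode

/-! ### One-state automata and disjoint languages. -/

/-- Over a finite alphabet, one-state automata accept only finitely many languages. -/
theorem MultiHeadFA.finite_range_language (k : ℕ) (A : Type) [Finite A] :
    (Set.range (language : MultiHeadFA k A (Fin 1) → Language A)).Finite := by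
  have : Finite (MultiHeadFA k A (Fin 1)) :=
    Finite.of_injective (fun M => (M.δ, M.start, M.accept)) (by
      rintro ⟨⟩ ⟨⟩ h
      simpa using h)
  exact Set.finite_range _

/-- The competitor is the one-state automaton without transitions and accepting states, which is of
every type; no automaton has fewer states, since there is an initial one. -/
theorem MultiHeadFA.card_eq_one_of_isStateMinimal {k n : ℕ} {A : Type}
    {M : MultiHeadFA k A (Fin n)} {t : Kind} (h : M.IsStateMinimal t) (hM : ∀ w, w ∉ M.language) :
    n = 1 := by
  let M₁ : MultiHeadFA k A (Fin 1) := ⟨fun _ _ => none, 0, ∅, by simp, by simp⟩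
  have hk : M₁.HasKind t := by
    cases t <;> simp [HasKind, IsOneWay, IsDeterministic, M₁]
  have hl : M₁.language = M.language := by
    ext w
    simp only [hM, iff_false]
    rintro ⟨c, -, hc, -⟩
    exact hc
  have h₁ := h (Fin 1) M₁ hk hl
  have h₂ := M.start.isLt
  simp only [Fintype.card_fin] at h₁
  omega

/-- The first `1` of `w` determines the number of zeros before it. -/
theorem List.replicate_zero_append_one_prefix_inj {n n' : ℕ} {w : List (Fin 2)}
    (h : List.replicate n 0 ++ [1] <+: w) (h' : List.replicate n' 0 ++ [1] <+: w) : n = n' := by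
  induction n generalizing n' w with
  | zero =>
    obtain ⟨v, rfl⟩ := h
    cases n' with
    | zero => rfl
    | succ n' => simp [List.replicate_succ] at h'
  | succ n ih =>
    obtain ⟨v, rfl⟩ := h
    cases n' with
    | zero => simp [List.replicate_succ] at h'
    | succ n' =>
      simp only [List.replicate_succ, List.cons_append, List.cons_prefix_cons, true_and] at h'
      rw [ih (List.prefix_append _ v) h']

namespace QueueInstr

/-- For a search problem, there is a computable sequence of automata the `n`-th of which accepts
some word if and only if the `n`-th instance is solvable, and no word is accepted by two of them. -/
theorem exists_automata {g : ℕ → ℕ → ℕ} (hg : Primrec₂ g) (hg₁ : ∀ n y, g n y ≤ 1) {k : ℕ}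
    (hk : 2 ≤ k) :
    ∃ (N : ℕ) (M : ∀ n, MultiHeadFA k (Fin 2) (Fin (N + n))) (c : ℕ → MultiHeadCode k),
      Computable c ∧ (∀ n, (c n).Describes (M n)) ∧ (∀ n t, (M n).HasKind t) ∧
      (∀ n, (∃ w, w ∈ (M n).language) ↔ ∃ y, g n y = 0) ∧
      ∀ n n' w, w ∈ (M n).language → w ∈ (M n').language → n = n' := by
  obtain ⟨p, hp⟩ := QueueProg.exists_search_program hg hg₁
  obtain ⟨N, prog, φ, s, hφ, hs⟩ := p.exists_finite_machine
  obtain ⟨c, hc, hd⟩ := MultiHeadCode.exists_computable_description hk prog s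
  have hprefix : ∀ n w, w ∈ (toFA hk (withPushes prog s n) (pushesStart s n)).language →
      (∃ y, g n y = 0) ∧ List.replicate n 0 ++ [1] <+: w := by
    intro n w hw
    obtain ⟨ψ, hψ, hψs⟩ := exists_map_withPushes hφ hs n
    obtain ⟨c₁, hc₁, hpast, hhalt, hloop⟩ := hp n
    have hmap : ∀ e, Reaches (withPushes prog s n) ⟨pushesStart s n, [], []⟩ e →
        Reaches QueueProg.instr ⟨List.replicate n (.push 0) ++ [p], [], []⟩ (e.map ψ) := by
      intro e he
      have := reaches_map_of_reaches hψ he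
      rwa [QueueConfig.map, hψs] at this
    -- A run that ends can end only in a genuine halt after the checkpoint `c₁`: for unsolvable `n`
    -- the run is infinite, and for solvable `n` determinism identifies the end with the known
    -- halting configuration.
    have hnone : ∀ e, Reaches (withPushes prog s n) ⟨pushesStart s n, [], []⟩ e →
        next (withPushes prog s n) e = none → (∃ y, g n y = 0) ∧
          QueueProg.instr (e.map ψ).state = halt ∧ Reaches QueueProg.instr c₁ (e.map ψ) := by
      intro e he hn
      have hn' : next QueueProg.instr (e.map ψ) = none := by rw [next_map hψ, hn]; rfl
      have hr := hc₁.of_halted (hmap e he) hn'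
      by_cases hy : ∃ y, g n y = 0
      · refine ⟨hy, ?_, hr⟩
        obtain ⟨c₂, hc₂, hc₂'⟩ := hhalt hy
        have := hr.of_halted hc₂ (by simp [next, hc₂'])
        rcases Relation.ReflTransGen.cases_head this with h | ⟨c', h, -⟩
        · rw [h, hc₂']
        · rw [hn'] at h; cases h
      · obtain ⟨c₂, hc₂, hc₂'⟩ := hloop (not_exists.1 hy)
        exact absurd hn' (hc₂' _ (hc₂.of_halted hr hn'))
    have hhalt_iff : ∀ e : QueueConfig (Fin (N + n)),
        QueueProg.instr (e.map ψ).state = halt → withPushes prog s n e.state = halt := by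
      intro e he
      change QueueProg.instr (ψ e.state) = halt at he
      rw [← hψ] at he
      generalize withPushes prog s n e.state = i at he
      cases i <;> simp_all [map]
    obtain ⟨e, he, hh, hpre⟩ := exists_reaches_of_mem_language
      (fun e he hn => hhalt_iff e (hnone e he hn).2.1) hw
    obtain ⟨hy, -, hr⟩ := hnone e he (by simp [next, hh])
    refine ⟨hy, ?_⟩
    rw [← hpast]
    exact (past_append_queue_prefix hr).trans hpre
  refine ⟨N, fun n => toFA hk (withPushes prog s n) (pushesStart s n), c, hc, hd,
    fun n t => hasKind_toFA hk _ _ t, fun n => ⟨fun ⟨w, hw⟩ => (hprefix n w hw).1, fun hy => ?_⟩,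
    fun n n' w hw hw' => List.replicate_zero_append_one_prefix_inj (hprefix n w hw).2
      (hprefix n' w hw').2⟩
  obtain ⟨ψ, hψ, hψs⟩ := exists_map_withPushes hφ hs n
  obtain ⟨c₁, hc₁, -, hhalt, -⟩ := hp n
  obtain ⟨c₂, hc₂, hc₂'⟩ := hhalt hy
  have hr : Reaches QueueProg.instr (QueueConfig.map ψ ⟨pushesStart s n, [], []⟩) c₂ := by
    rw [QueueConfig.map, hψs]
    exact hc₁.trans hc₂
  obtain ⟨e, rfl, he⟩ := exists_reaches_of_reaches_map hψ hr
  refine language_toFA_nonempty hk he ?_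
  change QueueProg.instr (ψ e.state) = halt at hc₂'
  rw [← hψ] at hc₂'
  generalize withPushes prog s n e.state = i at hc₂'
  cases i <;> simp_all [map]

end QueueInstr

/-! ### The reduction from the halting problem. -/

open Nat.Partrec (Code) in
/-- The halting problem as a search problem. -/
theorem exists_primrec_not_computablePred :
    ∃ g : ℕ → ℕ → ℕ, Primrec₂ g ∧ (∀ n y, g n y ≤ 1) ∧ ¬ ComputablePred fun n => ∃ y, g n y = 0 := by
  -- The number `y` bounds the evaluation of the `n`-th code at input `0`; a zero of `g n` witnesses
  -- halting.
  refine ⟨fun n y => if Code.evaln y (Denumerable.ofNat Code n) 0 = none then 1 else 0, ?_, ?_, ?_⟩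
  · refine Primrec.ite (Primrec.eq.comp ?_ (.const none)) (.const 1) (.const 0)
    exact Code.primrec_evaln.comp
      ((Primrec.snd.pair ((Primrec.ofNat Code).comp .fst)).pair (.const 0))
  · intro n y
    dsimp only
    split <;> simp
  · intro h
    refine ComputablePred.halting_problem 0 (ComputablePred.computable_of_manyOneReducible
      ⟨Encodable.encode, Computable.encode, fun c => ?_⟩ h)
    simp only [Denumerable.ofNat_encode, Part.dom_iff_mem, Code.evaln_complete]
    constructor
    · rintro ⟨x, y, h⟩
      exact ⟨y, by simp [Option.mem_def.1 h]⟩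
    · rintro ⟨y, h⟩
      cases h' : Code.evaln y c 0 with
      | none => simp [h'] at h
      | some x => exact ⟨x, y, h'⟩

/-- A predicate that differs only finitely from one that can be read off from a computable function
is computable. -/
theorem ComputablePred.of_finite_diff {D : ℕ → Prop} {h : ℕ → ℕ} (hh : Computable h)
    (h₁ : ∀ n, ¬ D n → h n = 1) (hfin : {n | D n ∧ h n = 1}.Finite) : ComputablePred D := by
  classical
  have hmem : PrimrecPred fun n => n ∈ {n | D n ∧ h n = 1} := by
    generalize {n | D n ∧ h n = 1} = s at hfin
    induction s, hfin using Set.Finite.induction_on with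
    | empty => exact (PrimrecPred.of_eq (Primrec.eq.comp (.const 0) (.const 1))) (by simp)
    | @insert a _ _ _ ih => exact ((Primrec.eq.comp .id (.const a)).or ih).of_eq (by simp)
  -- `D n` holds exactly if `n` is one of the finitely many exceptions or `h n ≠ 1`.
  have hp : PrimrecPred fun x : ℕ × ℕ => x.2 ∈ {n | D n ∧ h n = 1} ∨ ¬ x.1 = 1 :=
    (hmem.comp .snd).or (Primrec.eq.comp .fst (.const 1)).not
  refine ⟨inferInstance, (hp.decide.to_comp.comp (hh.pair .id)).of_eq fun n => ?_⟩
  have := h₁ n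
  simp only [Set.mem_ofPred_eq, id_eq, decide_eq_decide]
  tauto

theorem mainTheorem8 (k : ℕ) (hk : 2 ≤ k) (t : MultiHeadFA.Kind) :
    ¬ ∃ f : MultiHeadCode k →. MultiHeadCode k, Partrec f ∧ IsStateMinimization k t f := by
  rintro ⟨f, hf, hmin⟩
  obtain ⟨g, hg, hg₁, hD⟩ := exists_primrec_not_computablePred
  obtain ⟨N, M, c, hc, hd, hkind, hne, hdisj⟩ := QueueInstr.exists_automata hg hg₁ hk
  choose c' hc' n' M' hd' hkind' hlang hmin' using
    fun n => hmin 2 (N + n) (M n) (hkind n t) (c n) (hd n)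
  refine hD (ComputablePred.of_finite_diff (h := fun n => (c' n).numStates) ?_ ?_ ?_)
  · have hnum : Computable (MultiHeadCode.numStates : MultiHeadCode k → ℕ) :=
      (Primrec.fst.comp (Primrec.of_equiv (e := MultiHeadCode.equivTuple k))).to_comp
    refine ((hf.comp hc).map (hnum.comp .snd).to₂).of_eq fun n => ?_
    rw [Part.eq_some_iff.2 (hc' n)]
    simp
  · intro n hn
    rw [(hd' n).numStates_eq]
    refine MultiHeadFA.card_eq_one_of_isStateMinimal (hmin' n) fun w hw => hn ((hne n).1 ⟨w, ?_⟩)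
    rwa [← hlang]
  -- On solvable instances `n ↦ (M n).language` is injective, and where `h n = 1` its values are
  -- languages of one-state automata.
  · refine Set.Finite.of_finite_image (f := fun n => (M n).language)
      ((MultiHeadFA.finite_range_language k (Fin 2)).subset ?_) ?_
    · rintro _ ⟨n, ⟨-, hn⟩, rfl⟩
      rw [(hd' n).numStates_eq] at hn
      have hex : ∀ m (M₁ : MultiHeadFA k (Fin 2) (Fin m)), m = 1 →
          M₁.language ∈ Set.range
            (MultiHeadFA.language : MultiHeadFA k (Fin 2) (Fin 1) → Language (Fin 2)) := by
        rintro _ M₁ rfl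
        exact ⟨M₁, rfl⟩
      have := hex _ (M' n) hn
      rwa [hlang] at this
    · rintro n ⟨hn, -⟩ n₁ - heq
      obtain ⟨w, hw⟩ := (hne n).2 hn
      refine hdisj n n₁ w hw ?_
      change (M n).language = (M n₁).language at heq
      rwa [← heq]
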